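/- All compact groups are Hausdorff. Let $H$ be a compact group and let $\iota_i : H\to G_i$ ($i\in I$, with $I$ an arbitrary set) be a family of continuous homomorphisms to compact groups, each of which is a split embedding: there are a compact group $H_i$, a continuous action $H\times H_i\to H_i$ of $H$ on $H_i$ by group automorphisms, and an isomorphism of topological groups $G_i\cong H_i\rtimes H$ (the semidirect product with the product topology) carrying $\iota_i$ to the inclusion of the factor $H$ into $H_i\rtimes H$. Then the family $(\iota_i)_{i\in I}$ is algebraically sound, that is, the canonical homomorphism $$\coprod_{H,\mathbf{Gp}} G_i\longrightarrow \coprod_{H,\mathbf{CGp}} G_i$$ from the multi-pushout (colimit) of the family $(\iota_i)$ in the category of groups (the free product of the groups $G_i$ amalgamated over $H$) to the multi-pushout of the same family in the category of compact groups and continuous homomorphisms is injective. -/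

import Mathlib

open Topology

/-- The semidirect product of topological groups carries the product topology. -/
instance SemidirectProduct.instTopologicalSpaceOfProd {N H : Type*} [Group N] [Group H]
    [TopologicalSpace N] [TopologicalSpace H] (φ : H →* MulAut N) :
    TopologicalSpace (N ⋊[φ] H) :=
  TopologicalSpace.induced (fun x => (x.left, x.right)) inferInstance

universe u v w

/-- A morphism `H → G` of topological groups is a *split embedding* of compact groups if, up to
an isomorphism of topological groups, it is the inclusion `H ≤ N ⋊ H` of the second factor for
some compact Hausdorff group `N` with a (jointly) continuous action of `H` by automorphisms. -/
def IsSplitEmbedding {H : Type u} {G : Type v}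
    [Group H] [TopologicalSpace H] [Group G] [TopologicalSpace G] (ι : H →ₜ* G) : Prop :=
  ∃ (N : Type v) (_ : Group N) (_ : TopologicalSpace N) (_ : IsTopologicalGroup N)
    (_ : CompactSpace N) (_ : T2Space N) (φ : H →* MulAut N),
    Continuous (fun p : H × N => φ p.1 p.2) ∧
      ∃ e : G ≃ₜ* (N ⋊[φ] H), ∀ h : H, e (ι h) = SemidirectProduct.inr h

section CompactPushout

variable {I : Type*} {H : Type*} [Group H] [TopologicalSpace H]
  {G : I → Type*} [∀ i, Group (G i)] [∀ i, TopologicalSpace (G i)]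

/-- The group-theoretic multi-pushout (free product of the `G i` amalgamated along `H`). -/
abbrev AlgPushout (ι : ∀ i, H →ₜ* G i) : Type _ :=
  Monoid.PushoutI (fun i => (ι i : H →* G i))

/-- A compact Hausdorff group under the diagram `(ι i)`, of bounded size: its underlying set is a
set of families of subsets of the algebraic pushout. Every compact Hausdorff group in which the
algebraic pushout has dense image is isomorphic to one of this kind, so that these
groups suffice to build the compact pushout without leaving the universe. -/
structure SmallCompactCocone (ι : ∀ i, H →ₜ* G i) where
  carrier : Set (Set (Set (AlgPushout ι)))
  [group : Group carrier]
  [top : TopologicalSpace carrier]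
  [topGroup : IsTopologicalGroup carrier]
  [compact : CompactSpace carrier]
  [t2 : T2Space carrier]
  /-- the morphisms of the cocone, assembled into one from the algebraic pushout -/
  hom : AlgPushout ι →* carrier
  continuous_base : Continuous fun h : H => hom (Monoid.PushoutI.base _ h)
  continuous_of : ∀ i, Continuous fun g : G i => hom (Monoid.PushoutI.of i g)

attribute [instance] SmallCompactCocone.group SmallCompactCocone.top
  SmallCompactCocone.topGroup SmallCompactCocone.compact SmallCompactCocone.t2

/-- The multi-pushout of the `ι i` in the category of compact Hausdorff groups: the closure of
the image of the algebraic pushout in the product of all compact groups under the diagram. Its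
universal property is `CompactPushout.existsUnique_desc`. -/
def CompactPushout (ι : ∀ i, H →ₜ* G i) : Subgroup (∀ c : SmallCompactCocone ι, c.carrier) :=
  (MonoidHom.pi fun c : SmallCompactCocone ι => c.hom).range.topologicalClosure

namespace CompactPushout

instance (ι : ∀ i, H →ₜ* G i) : CompactSpace (CompactPushout ι) :=
  isCompact_iff_compactSpace.1 (Subgroup.isClosed_topologicalClosure _).isCompact

/-- The structure map from `G i` to the compact pushout. -/
def of (ι : ∀ i, H →ₜ* G i) (i : I) : G i →ₜ* CompactPushout ι where
  toFun g := ⟨fun c => c.hom (Monoid.PushoutI.of i g),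
    Subgroup.le_topologicalClosure _ ⟨Monoid.PushoutI.of i g, rfl⟩⟩
  map_one' := by ext c; simp
  map_mul' x y := by ext c; simp
  continuous_toFun :=
    Continuous.subtype_mk (continuous_pi fun c => c.continuous_of i) _

/-- The structure map from `H` to the compact pushout. -/
def base (ι : ∀ i, H →ₜ* G i) : H →ₜ* CompactPushout ι where
  toFun h := ⟨fun c => c.hom (Monoid.PushoutI.base _ h),
    Subgroup.le_topologicalClosure _ ⟨Monoid.PushoutI.base _ h, rfl⟩⟩
  map_one' := by ext c; simp
  map_mul' x y := by ext c; simp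
  continuous_toFun :=
    Continuous.subtype_mk (continuous_pi fun c => c.continuous_base) _

theorem of_apply_eq_base (ι : ∀ i, H →ₜ* G i) (i : I) (h : H) : of ι i (ι i h) = base ι h := by
  refine Subtype.ext (funext fun c => ?_)
  exact congrArg c.hom (Monoid.PushoutI.of_apply_eq_base (fun i => (ι i : H →* G i)) i h)

/-- The canonical map from the algebraic pushout to the compact pushout. -/
def ofAlg (ι : ∀ i, H →ₜ* G i) : AlgPushout ι →* CompactPushout ι :=
  Monoid.PushoutI.lift (fun i => (of ι i : G i →* CompactPushout ι))
    (base ι : H →* CompactPushout ι)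
    (fun i => MonoidHom.ext fun h => of_apply_eq_base ι i h)

theorem ofAlg_apply_coe (ι : ∀ i, H →ₜ* G i) (x : AlgPushout ι) (c : SmallCompactCocone ι) :
    (ofAlg ι x : ∀ c : SmallCompactCocone ι, c.carrier) c = c.hom x := by
  have : (((Pi.evalMonoidHom (fun c : SmallCompactCocone ι => c.carrier) c).comp
      (CompactPushout ι).subtype).comp (ofAlg ι)) = c.hom := by
    refine Monoid.PushoutI.hom_ext (fun i => ?_) ?_
    · refine MonoidHom.ext fun g => ?_
      simp only [ofAlg, MonoidHom.comp_apply, Monoid.PushoutI.lift_of]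
      rfl
    · refine MonoidHom.ext fun h => ?_
      simp only [ofAlg, MonoidHom.comp_apply, Monoid.PushoutI.lift_base]
      rfl
  exact DFunLike.congr_fun this x

theorem denseRange_ofAlg (ι : ∀ i, H →ₜ* G i) : DenseRange (ofAlg ι) := by
  intro x
  rw [Topology.IsInducing.subtypeVal.closure_eq_preimage_closure_image]
  have hx := x.2
  have key : ((↑) '' Set.range (ofAlg ι) : Set (∀ c : SmallCompactCocone ι, c.carrier)) =
      (MonoidHom.pi fun c : SmallCompactCocone ι => c.hom).range := by
    ext y
    constructor
    · rintro ⟨_, ⟨a, rfl⟩, rfl⟩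
      exact ⟨a, funext fun c => (ofAlg_apply_coe ι a c).symm⟩
    · rintro ⟨a, rfl⟩
      exact ⟨_, ⟨a, rfl⟩, funext fun c => ofAlg_apply_coe ι a c⟩
  show (x : ∀ c : SmallCompactCocone ι, c.carrier) ∈ closure _
  exact (congrArg (fun s => x.1 ∈ closure s) key).mpr hx

/-- A compact group receiving the diagram with dense image is a small cocone. -/
theorem exists_small (ι : ∀ i, H →ₜ* G i) {K : Type w} [Group K] [TopologicalSpace K]
    [IsTopologicalGroup K] [CompactSpace K] [T2Space K] (f : AlgPushout ι →* K)
    (hd : DenseRange f)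
    (hb : Continuous fun h : H => f (Monoid.PushoutI.base _ h))
    (ho : ∀ i, Continuous fun g : G i => f (Monoid.PushoutI.of i g)) :
    ∃ (c : SmallCompactCocone ι) (F : c.carrier →ₜ* K), ∀ x, F (c.hom x) = f x := by
  let e : K → Set (Set (AlgPushout ι)) := fun k => (Filter.comap f (𝓝 k)).sets
  have he : Function.Injective e := by
    intro a b hab
    have h1 : Filter.comap f (𝓝 a) = Filter.comap f (𝓝 b) := Filter.filter_eq hab
    have : (Filter.comap f (𝓝 a)).NeBot := Filter.comap_neBot fun t ht => by
      obtain ⟨_, hy, x, rfl⟩ := mem_closure_iff_nhds.1 (hd a) t ht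
      exact ⟨x, hy⟩
    exact tendsto_nhds_unique (f := f) (l := Filter.comap f (𝓝 a)) Filter.tendsto_comap
      (h1 ▸ Filter.tendsto_comap)
  let E : K ≃ Set.range e := Equiv.ofInjective e he
  let : Group (Set.range e) := E.symm.group
  let : TopologicalSpace (Set.range e) := TopologicalSpace.induced E.symm inferInstance
  let M : Set.range e ≃* K := E.symm.mulEquiv
  have hM : Topology.IsInducing M := ⟨rfl⟩
  let T : Set.range e ≃ₜ K := M.toEquiv.toHomeomorphOfIsInducing hM
  have : IsTopologicalGroup (Set.range e) := topologicalGroup_induced M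
  have : CompactSpace (Set.range e) := T.symm.compactSpace
  have : T2Space (Set.range e) := T.symm.t2Space
  refine ⟨{ carrier := Set.range e
            hom := (M.symm : K →* Set.range e).comp f
            continuous_base := T.symm.continuous.comp hb
            continuous_of := fun i => T.symm.continuous.comp (ho i) },
    ⟨(M : Set.range e →* K), T.continuous⟩, fun x => M.apply_symm_apply (f x)⟩

/-- The universal property of the compact pushout. -/
theorem existsUnique_desc (ι : ∀ i, H →ₜ* G i) {K : Type w} [Group K] [TopologicalSpace K]
    [IsTopologicalGroup K] [CompactSpace K] [T2Space K] (f : ∀ i, G i →ₜ* K) (k : H →ₜ* K)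
    (hf : ∀ i h, f i (ι i h) = k h) :
    ∃! F : CompactPushout ι →ₜ* K, (∀ i g, F (of ι i g) = f i g) ∧ ∀ h, F (base ι h) = k h := by
  let f₀ : AlgPushout ι →* K := Monoid.PushoutI.lift (fun i => (f i : G i →* K)) (k : H →* K)
    (fun i => MonoidHom.ext fun h => hf i h)
  have hfo : ∀ i g, f₀ (Monoid.PushoutI.of i g) = f i g := fun i g => by simp [f₀]
  have hfb : ∀ h, f₀ (Monoid.PushoutI.base _ h) = k h := fun h => by simp [f₀]
  let K₀ : Subgroup K := f₀.range.topologicalClosure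
  have : CompactSpace K₀ :=
    isCompact_iff_compactSpace.1 (Subgroup.isClosed_topologicalClosure _).isCompact
  let f₁ : AlgPushout ι →* K₀ :=
    f₀.codRestrict K₀ fun x => Subgroup.le_topologicalClosure _ ⟨x, rfl⟩
  have hd : DenseRange f₁ := by
    intro x
    rw [Topology.IsInducing.subtypeVal.closure_eq_preimage_closure_image]
    have key : ((↑) '' Set.range f₁ : Set K) = f₀.range := by
      rw [← Set.range_comp]; rfl
    show (x : K) ∈ closure _
    exact (congrArg (fun s => x.1 ∈ closure s) key).mpr x.2
  obtain ⟨c, F, hF⟩ := exists_small ι f₁ hd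
    (Continuous.subtype_mk (k.continuous_toFun.congr fun h => (hfb h).symm) _)
    (fun i => Continuous.subtype_mk ((f i).continuous_toFun.congr fun g => (hfo i g).symm) _)
  refine ⟨⟨(K₀.subtype.comp (F : c.carrier →* K₀)).comp
      ((Pi.evalMonoidHom (fun c : SmallCompactCocone ι => c.carrier) c).comp
        (CompactPushout ι).subtype), ?_⟩, ⟨fun i g => ?_, fun h => ?_⟩, ?_⟩
  · exact continuous_subtype_val.comp (F.continuous_toFun.comp
      ((continuous_apply c).comp continuous_subtype_val))
  · exact (congrArg Subtype.val (hF (Monoid.PushoutI.of i g))).trans (hfo i g)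
  · exact (congrArg Subtype.val (hF (Monoid.PushoutI.base _ h))).trans (hfb h)
  · have main : ∀ A B : CompactPushout ι →ₜ* K,
        ((∀ i g, A (of ι i g) = f i g) ∧ ∀ h, A (base ι h) = k h) →
        ((∀ i g, B (of ι i g) = f i g) ∧ ∀ h, B (base ι h) = k h) → A = B := by
      intro A B hA hB
      have h1 : (A : CompactPushout ι →* K).comp (ofAlg ι) =
          (B : CompactPushout ι →* K).comp (ofAlg ι) := by
        refine Monoid.PushoutI.hom_ext (fun i => ?_) ?_
        · ext g; simp [ofAlg, hA.1, hB.1]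
        · ext h; simp [ofAlg, hA.2, hB.2]
      have h2 : (A : CompactPushout ι → K) = B :=
        (denseRange_ofAlg ι).equalizer A.continuous_toFun B.continuous_toFun
          (funext fun x => DFunLike.congr_fun h1 x)
      exact DFunLike.coe_injective h2
    intro A hA
    refine main _ _ hA ⟨fun i g => ?_, fun h => ?_⟩
    · exact (congrArg Subtype.val (hF (Monoid.PushoutI.of i g))).trans (hfo i g)
    · exact (congrArg Subtype.val (hF (Monoid.PushoutI.base _ h))).trans (hfb h)

end CompactPushout

/-- The family `(ι i)` is *algebraically sound* if the canonical map from the group-theoretic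
multi-pushout to the multi-pushout in compact groups is one-to-one. -/
def AlgebraicallySound (ι : ∀ i, H →ₜ* G i) : Prop :=
  Function.Injective (CompactPushout.ofAlg ι)

end CompactPushout

/-! A split embedding enters only through its continuous retraction `p i : G i → H`. An element of
the amalgam is an element of `H` times a reduced word whose letters lie outside `H`. If the word is
empty, the retractions glue to a map onto the compact group `H` that is the identity on `H`.
Otherwise it is enough to find compatible finite-dimensional orthogonal representations of the `G i`
in which the element acts nontrivially, since orthogonal groups are compact.

These are built by induction on the word, read from the right (`LayeredRep.exists_of_reduced`). The
space is a sum of a lower and a top layer. A vector and its images under all proper suffixes lie in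
the lower layer, but its image under the whole word does not. Every group, except that of the
leftmost letter, preserves the layers and acts on the top one, `T`, through its retraction. To
prepend `g ∈ G l`, take an orthogonal representation `σ` of `G l` on `ℝ ⊕ D` in which `H` fixes the
first basis vector and `g` moves its line. Let `G l` act on `(ℝ ⊕ D) ⊗ T` by `σ ⊗ T`. Over `H` this
splits as `T ⊕ (D ⊗ T)`, so the other groups can keep their old action and act on the new top layer
`D ⊗ T` through `H`. The `D`-component of `σ g` pushes the vector into `D ⊗ T`.

The representation `σ` comes from a Peter–Weyl theorem for `G l` modulo `H`
(`exists_finiteDimensional_of_notMem`), proved with compact self-adjoint smoothing operators. -/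

/-! ### Integral operators with continuous kernel -/

section Kernel

variable {X E : Type*} [TopologicalSpace X] [CompactSpace X] [NormedAddCommGroup E]
  [InnerProductSpace ℝ E]

/-- The operator attached to a continuous family `K` of vectors, sending `f` to the function
`x ↦ ⟪K x, f⟫`. -/
noncomputable def ContinuousMap.innerOperator (K : C(X, E)) : E →L[ℝ] C(X, ℝ) :=
  LinearMap.mkContinuous
    { toFun := fun f => ⟨fun x => inner ℝ (K x) f, by fun_prop⟩
      map_add' := fun f g => by ext x; simp [inner_add_right]
      map_smul' := fun r f => by ext x; simp [inner_smul_right] } ‖K‖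
    (fun f => (ContinuousMap.norm_le _ (by positivity)).2 fun x =>
      (norm_inner_le_norm _ _).trans
        (mul_le_mul_of_nonneg_right (K.norm_coe_le_norm x) (norm_nonneg f)))

/-- Arzelà–Ascoli: on the unit ball the image functions are bounded by `‖K‖` and share the modulus
of continuity `‖K x₀ - K x‖` at `x₀`. -/
theorem ContinuousMap.isCompactOperator_innerOperator (K : C(X, E)) :
    IsCompactOperator K.innerOperator := by
  let e := ContinuousMap.linearIsometryBoundedOfCompact X ℝ ℝ
  have he : IsCompact (closure (e '' (K.innerOperator '' Metric.ball 0 1))) := by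
    refine BoundedContinuousFunction.arzela_ascoli (Metric.closedBall 0 ‖K‖)
      (isCompact_closedBall _ _) _ ?_ ?_
    · rintro _ x ⟨_, ⟨f, hf, rfl⟩, rfl⟩
      rw [mem_closedBall_zero_iff]
      have h1 : ‖f‖ ≤ 1 := (mem_ball_zero_iff.1 hf).le
      calc ‖inner ℝ (K x) f‖ ≤ ‖K x‖ * ‖f‖ := norm_inner_le_norm _ _
        _ ≤ ‖K‖ * 1 := mul_le_mul (K.norm_coe_le_norm x) h1 (norm_nonneg _) (norm_nonneg _)
        _ = ‖K‖ := mul_one _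
    · intro x₀
      refine Metric.equicontinuousAt_of_continuity_modulus (fun x => ‖K x₀ - K x‖) ?_ _ ?_
      · have : Continuous fun x => ‖K x₀ - K x‖ := by fun_prop
        simpa using this.tendsto x₀
      · refine Filter.Eventually.of_forall ?_
        rintro x ⟨_, _, ⟨f, hf, rfl⟩, rfl⟩
        have h1 : ‖f‖ ≤ 1 := (mem_ball_zero_iff.1 hf).le
        change dist (inner ℝ (K x₀) f) (inner ℝ (K x) f) ≤ _
        rw [dist_eq_norm, ← inner_sub_left]
        exact (norm_inner_le_norm _ _).trans (mul_le_of_le_one_right (norm_nonneg _) h1)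
  refine (isCompactOperator_iff_exists_mem_nhds_image_subset_compact _).2
    ⟨Metric.ball 0 1, Metric.ball_mem_nhds _ one_pos, _, he.image e.symm.continuous, ?_⟩
  intro c hc
  exact ⟨e c, subset_closure ⟨c, hc, rfl⟩, e.symm_apply_apply c⟩

end Kernel

/-! ### Translation-invariant integral operators on a compact group -/

section Haar

open MeasureTheory

variable {G : Type*} [Group G] [TopologicalSpace G] [IsTopologicalGroup G]

/-- Left translation of continuous functions by an element of a topological group. -/
def leftTranslate (g : G) : C(G, ℝ) →L[ℝ] C(G, ℝ) where
  toFun f := f.comp ⟨fun y => g⁻¹ * y, by fun_prop⟩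
  map_add' _ _ := rfl
  map_smul' _ _ := rfl
  cont := ContinuousMap.continuous_precomp _

@[simp]
theorem leftTranslate_apply (g : G) (f : C(G, ℝ)) (y : G) : leftTranslate g f y = f (g⁻¹ * y) := rfl

theorem leftTranslate_one (f : C(G, ℝ)) : leftTranslate 1 f = f := by ext; simp

theorem leftTranslate_mul (g h : G) (f : C(G, ℝ)) :
    leftTranslate (g * h) f = leftTranslate g (leftTranslate h f) := by
  ext; simp [mul_assoc]

theorem continuous_leftTranslate (f : C(G, ℝ)) : Continuous fun g : G => leftTranslate g f :=
  (ContinuousMap.curry ⟨fun p : G × G => f (p.1⁻¹ * p.2), by fun_prop⟩).continuous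

variable [CompactSpace G] [MeasurableSpace G] [BorelSpace G] (μ : Measure G)

section

variable [IsFiniteMeasure μ]

/-- The embedding of continuous functions into square-integrable functions. -/
noncomputable abbrev toL2 {X : Type*} [TopologicalSpace X] [CompactSpace X] [MeasurableSpace X]
    [BorelSpace X] (μ : Measure X) [IsFiniteMeasure μ] : C(X, ℝ) →L[ℝ] Lp ℝ 2 μ := ContinuousMap.toLp 2 μ ℝ

theorem inner_toL2 {X : Type*} [TopologicalSpace X] [CompactSpace X] [MeasurableSpace X]
    [BorelSpace X] (μ : Measure X) [IsFiniteMeasure μ] (a b : C(X, ℝ)) : inner ℝ (toL2 μ a) (toL2 μ b) = ∫ y, a y * b y ∂μ := by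
  rw [ContinuousMap.inner_toLp]
  simp [mul_comm]

theorem inner_toL2_leftTranslate [μ.IsMulLeftInvariant] (g : G) (a b : C(G, ℝ)) :
    inner ℝ (toL2 μ (leftTranslate g a)) (toL2 μ (leftTranslate g b)) =
      inner ℝ (toL2 μ a) (toL2 μ b) := by
  simp only [inner_toL2, leftTranslate_apply]
  exact integral_mul_left_eq_self (fun y => a y * b y) g⁻¹

/-- The family of translates of a kernel. -/
noncomputable def kernelFamily (k : C(G, ℝ)) : C(G, Lp ℝ 2 μ) :=
  ⟨fun y => toL2 μ (leftTranslate y k), (toL2 μ).continuous.comp (continuous_leftTranslate k)⟩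

/-- The smoothing operator `f ↦ ∫ k(y⁻¹ u) f(u) du`. -/
noncomputable def smoothing (k : C(G, ℝ)) : Lp ℝ 2 μ →L[ℝ] C(G, ℝ) :=
  (kernelFamily μ k).innerOperator

theorem smoothing_apply (k : C(G, ℝ)) (f : Lp ℝ 2 μ) (y : G) :
    smoothing μ k f y = inner ℝ (toL2 μ (leftTranslate y k)) f := rfl

theorem smoothing_toL2_apply (k f : C(G, ℝ)) (y : G) :
    smoothing μ k (toL2 μ f) y = ∫ u, k (y⁻¹ * u) * f u ∂μ := by
  rw [smoothing_apply, inner_toL2]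
  simp

/-- The kernel `k (y⁻¹ * u)` depends only on the relative position of `y` and `u`, so smoothing
commutes with translations and its eigenspaces are subrepresentations. -/
theorem smoothing_toL2_leftTranslate [μ.IsMulLeftInvariant] (k f : C(G, ℝ)) (g : G) :
    smoothing μ k (toL2 μ (leftTranslate g f)) = leftTranslate g (smoothing μ k (toL2 μ f)) := by
  ext y
  rw [leftTranslate_apply, smoothing_apply, smoothing_apply,
    ← inner_toL2_leftTranslate μ g (leftTranslate (g⁻¹ * y) k), ← leftTranslate_mul,
    mul_inv_cancel_left]

/-- The smoothing operator as an operator on square-integrable functions. -/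
noncomputable def smoothingL2 (k : C(G, ℝ)) : Lp ℝ 2 μ →L[ℝ] Lp ℝ 2 μ :=
  (toL2 μ).comp (smoothing μ k)

theorem isCompactOperator_smoothingL2 (k : C(G, ℝ)) : IsCompactOperator (smoothingL2 μ k) :=
  (kernelFamily μ k).isCompactOperator_innerOperator.clm_comp (toL2 μ)

/-- Continuous functions are dense, and for them this is Fubini together with `k (u⁻¹ * y) = k (y⁻¹
* u)`. The version of Fubini for continuous functions of compact support needs no countability
assumption on `G`. -/
theorem isSymmetric_smoothingL2 [T2Space G] [μ.WeaklyRegular] (k : C(G, ℝ)) (hk : ∀ g, k g⁻¹ = k g) :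
    (smoothingL2 μ k : Lp ℝ 2 μ →ₗ[ℝ] Lp ℝ 2 μ).IsSymmetric := by
  intro f g
  have hd : DenseRange (toL2 μ) := ContinuousMap.toLp_denseRange ℝ μ ℝ (by norm_num)
  change inner ℝ (smoothingL2 μ k f) g = inner ℝ f (smoothingL2 μ k g)
  refine hd.induction_on₂ (p := fun f g => inner ℝ (smoothingL2 μ k f) g =
    inner ℝ f (smoothingL2 μ k g)) (isClosed_eq (by fun_prop) (by fun_prop)) (fun a b => ?_) f g
  change inner ℝ (toL2 μ (smoothing μ k (toL2 μ a))) (toL2 μ b) =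
    inner ℝ (toL2 μ a) (toL2 μ (smoothing μ k (toL2 μ b)))
  simp only [inner_toL2, smoothing_toL2_apply, ← integral_const_mul, ← integral_mul_const]
  rw [integral_integral_swap_of_hasCompactSupport]
  · refine integral_congr_ae (Filter.Eventually.of_forall fun u => integral_congr_ae
      (Filter.Eventually.of_forall fun y => ?_))
    have : k (u⁻¹ * y) = k (y⁻¹ * u) := by rw [← hk]; simp
    simp only [this]
    ring
  · fun_prop
  · exact HasCompactSupport.of_compactSpace _

end

end Haar

/-! ### Peter–Weyl theorem for homogeneous spaces of a compact group -/

section PeterWeyl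

open MeasureTheory

variable {G : Type*} [Group G] [TopologicalSpace G] [IsTopologicalGroup G]

/-- The continuous functions invariant under left translation by a subgroup. -/
def leftInvariants (H : Subgroup G) : Submodule ℝ C(G, ℝ) where
  carrier := {f | ∀ h ∈ H, leftTranslate h f = f}
  add_mem' ha hb h hh := by rw [map_add, ha h hh, hb h hh]
  zero_mem' h _ := map_zero _
  smul_mem' r f hf h hh := by rw [map_smul, hf h hh]

theorem mem_leftInvariants {H : Subgroup G} {f : C(G, ℝ)} :
    f ∈ leftInvariants H ↔ ∀ h ∈ H, leftTranslate h f = f := Iff.rfl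

theorem isClosed_leftInvariants (H : Subgroup G) :
    IsClosed (leftInvariants H : Set C(G, ℝ)) := by
  have : (leftInvariants H : Set C(G, ℝ)) = ⋂ h ∈ H, {f | leftTranslate h f = f} := by
    ext f; simp [mem_leftInvariants]
  rw [this]
  exact isClosed_biInter fun h _ => isClosed_eq (leftTranslate h).continuous continuous_id

variable [CompactSpace G]

/-- An invariant function on a compact group taking the value `1/2` at `1` and vanishing near a
given point outside of a closed subgroup. -/
theorem exists_leftInvariant_bump {H : Subgroup G} (hH : IsClosed (H : Set G)) {x : G}
    (hx : x ∉ H) :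
    ∃ f ∈ leftInvariants H, (∀ y, 0 ≤ f y) ∧ f 1 ≠ 0 ∧ ∀ᶠ y in 𝓝 x⁻¹, f y = 0 := by
  have : IsClosed (H : Set G) := hH
  have hne : (QuotientGroup.mk x : G ⧸ H) ≠ QuotientGroup.mk 1 := by
    intro h
    exact hx (by simpa using QuotientGroup.eq.1 h)
  obtain ⟨f₀, h0, h1, -⟩ := exists_continuous_zero_one_of_isClosed
    (isClosed_singleton (x := (QuotientGroup.mk x : G ⧸ H)))
    (isClosed_singleton (x := (QuotientGroup.mk 1 : G ⧸ H))) (by simpa using hne)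
  have h0' : f₀ (QuotientGroup.mk x : G ⧸ H) = 0 := h0 rfl
  have h1' : f₀ (QuotientGroup.mk 1 : G ⧸ H) = 1 := h1 rfl
  have hc : Continuous fun y : G => f₀ (QuotientGroup.mk y⁻¹ : G ⧸ H) :=
    f₀.continuous.comp (QuotientGroup.continuous_mk.comp continuous_inv)
  -- Inverting `y` turns functions on `G ⧸ H` into left-invariant ones; cutting off at `1 / 2` makes
  -- the function vanish on a neighbourhood of `x⁻¹`, not only at that point.
  refine ⟨⟨fun y => max (f₀ (QuotientGroup.mk y⁻¹ : G ⧸ H) - 1 / 2) 0, by fun_prop⟩, ?_, ?_, ?_, ?_⟩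
  · intro h hh
    ext y
    have : (QuotientGroup.mk (h⁻¹ * y)⁻¹ : G ⧸ H) = QuotientGroup.mk y⁻¹ := by
      rw [QuotientGroup.eq]
      simpa using H.inv_mem hh
    simp only [leftTranslate_apply, ContinuousMap.coe_mk, this]
  · intro y
    exact le_max_right _ _
  · have : (1 : ℝ) - 1 / 2 > 0 := by norm_num
    simp only [ContinuousMap.coe_mk, inv_one, h1']
    norm_num
  · have hlt : f₀ (QuotientGroup.mk x⁻¹⁻¹ : G ⧸ H) < 1 / 2 := by rw [inv_inv, h0']; norm_num
    filter_upwards [hc.continuousAt.eventually_lt continuousAt_const hlt] with y hy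
    simp only [ContinuousMap.coe_mk]
    exact max_eq_right (by linarith)

/-- A nonnegative symmetric bump function. -/
theorem exists_symmetric_bump [T2Space G] {U : Set G} (hU : U ∈ 𝓝 (1 : G)) :
    ∃ k : C(G, ℝ), (∀ g, k g⁻¹ = k g) ∧ (∀ g, 0 ≤ k g) ∧ k 1 ≠ 0 ∧ ∀ g, k g ≠ 0 → g ∈ U := by
  obtain ⟨V, hVU, hV, h1V⟩ := mem_nhds_iff.1 hU
  obtain ⟨κ, h0, h1, h01⟩ := exists_continuous_zero_one_of_isClosed hV.isClosed_compl
    (isClosed_singleton (x := (1 : G))) (by simpa using h1V)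
  have h1' : κ 1 = 1 := h1 rfl
  refine ⟨⟨fun g => κ g * κ g⁻¹, by fun_prop⟩, fun g => ?_, fun g => ?_, ?_, fun g hg => ?_⟩
  · simp [mul_comm]
  · exact mul_nonneg (h01 g).1 (h01 _).1
  · simp [h1']
  · by_contra hgU
    have : κ g = 0 := h0 fun h => hgU (hVU h)
    simp [this] at hg

section

variable [MeasurableSpace G] [BorelSpace G] (μ : Measure G) [IsFiniteMeasure μ]

/-- The bump `f` vanishes near `x⁻¹` but not at `1`. With `k` concentrated near `1`, the smoothed
function is zero at `x⁻¹` and positive at `1`, so translation by `x` changes its value at `1`. -/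
theorem exists_smoothing_ne [T2Space G] [μ.IsOpenPosMeasure] {H : Subgroup G} (hH : IsClosed (H : Set G)) {x : G} (hx : x ∉ H) :
    ∃ k : C(G, ℝ), (∀ g, k g⁻¹ = k g) ∧ ∃ f ∈ leftInvariants H,
      leftTranslate x (smoothing μ k (toL2 μ f)) ≠ smoothing μ k (toL2 μ f) := by
  obtain ⟨f, hf, hf0, hf1, hfx⟩ := exists_leftInvariant_bump hH hx
  have hU : {g | f (x⁻¹ * g) = 0} ∈ 𝓝 (1 : G) := by
    have : Filter.Tendsto (fun g : G => x⁻¹ * g) (𝓝 1) (𝓝 x⁻¹) := by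
      have h : Continuous fun g : G => x⁻¹ * g := by fun_prop
      simpa using h.tendsto 1
    exact this.eventually hfx
  obtain ⟨k, hk, hk0, hk1, hkU⟩ := exists_symmetric_bump hU
  refine ⟨k, hk, f, hf, fun h => ?_⟩
  have h1 := DFunLike.congr_fun h 1
  rw [leftTranslate_apply, smoothing_toL2_apply, smoothing_toL2_apply] at h1
  have hz : ∀ u, k ((x⁻¹ * 1)⁻¹ * u) * f u = 0 := by
    intro u
    by_cases hku : k ((x⁻¹ * 1)⁻¹ * u) = 0
    · rw [hku, zero_mul]
    · have := hkU _ hku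
      simp only [Set.mem_ofPred_eq, mul_one, inv_inv, inv_mul_cancel_left] at this
      rw [this, mul_zero]
  have hpos : 0 < ∫ u, k (1⁻¹ * u) * f u ∂μ := by
    refine Continuous.integral_pos_of_hasCompactSupport_nonneg_nonzero (x := 1) (by fun_prop)
      (HasCompactSupport.of_compactSpace _) (fun u => mul_nonneg (hk0 _) (hf0 _)) ?_
    simpa using ⟨hk1, hf1⟩
  simp only [hz, integral_zero] at h1
  exact hpos.ne h1

/-- The eigenspace of a smoothing operator, as a space of continuous functions. -/
noncomputable def smoothingEigenspace (k : C(G, ℝ)) (r : ℝ) : Submodule ℝ C(G, ℝ) :=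
  LinearMap.ker (((smoothing μ k).comp (toL2 μ) - r • ContinuousLinearMap.id ℝ C(G, ℝ) :
    C(G, ℝ) →L[ℝ] C(G, ℝ)) : C(G, ℝ) →ₗ[ℝ] C(G, ℝ))

theorem mem_smoothingEigenspace {k : C(G, ℝ)} {r : ℝ} {f : C(G, ℝ)} :
    f ∈ smoothingEigenspace μ k r ↔ smoothing μ k (toL2 μ f) = r • f := by
  simp [smoothingEigenspace, sub_eq_zero]

/-- Since `μ` charges open sets, continuous functions embed in `L²`, where the eigenspaces of a
compact operator for nonzero eigenvalues are finite-dimensional. -/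
theorem finiteDimensional_smoothingEigenspace [μ.IsOpenPosMeasure] (k : C(G, ℝ)) {r : ℝ} (hr : r ≠ 0) : FiniteDimensional ℝ (smoothingEigenspace μ k r) := by
  have : FiniteDimensional ℝ (Module.End.eigenspace (smoothingL2 μ k).toLinearMap r) :=
    ContinuousLinearMap.finite_dimensional_eigenspace (isCompactOperator_smoothingL2 μ k) r hr
  let F : smoothingEigenspace μ k r →ₗ[ℝ] Module.End.eigenspace (smoothingL2 μ k).toLinearMap r :=
    ((toL2 μ).toLinearMap.domRestrict _).codRestrict _ fun f => by
      rw [Module.End.mem_eigenspace_iff]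
      have := (mem_smoothingEigenspace μ).1 f.2
      change toL2 μ (smoothing μ k (toL2 μ f)) = r • toL2 μ f
      rw [this, map_smul]
  refine FiniteDimensional.of_injective F fun a b h => Subtype.ext ?_
  exact ContinuousMap.toLp_injective μ (congrArg Subtype.val h)

end

/-- The Peter–Weyl theorem for homogeneous spaces: a point outside of a closed subgroup is
detected by an invariant vector in a finite-dimensional space of continuous functions. -/
theorem exists_finiteDimensional_of_notMem [T2Space G] {H : Subgroup G} (hH : IsClosed (H : Set G)) {x : G}
    (hx : x ∉ H) :
    ∃ E : Submodule ℝ C(G, ℝ), FiniteDimensional ℝ E ∧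
      (∀ g, ∀ f ∈ E, leftTranslate g f ∈ E) ∧
      ∃ f ∈ E, f ∈ leftInvariants H ∧ leftTranslate x f ≠ f := by
  let _ : MeasurableSpace G := borel G
  have : BorelSpace G := ⟨rfl⟩
  let μ : Measure G := Measure.haarMeasure ⊤
  obtain ⟨k, hk, f, hf, hne⟩ := exists_smoothing_ne μ hH hx
  by_contra! hcon
  have hE : ∀ r : ℝ, r ≠ 0 → ∀ c ∈ smoothingEigenspace μ k r, c ∈ leftInvariants H →
      leftTranslate x c = c := by
    intro r hr c hc
    refine hcon _ (finiteDimensional_smoothingEigenspace μ k hr) (fun g a ha => ?_) c hc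
    rw [mem_smoothingEigenspace] at ha ⊢
    rw [smoothing_toL2_leftTranslate, ha, map_smul]
  -- The spectral theorem is applied on the closure of the `H`-invariant functions, so that the
  -- eigenvectors it yields become `H`-invariant after smoothing.
  let W : Submodule ℝ (Lp ℝ 2 μ) := ((leftInvariants H).map (toL2 μ).toLinearMap).topologicalClosure
  have hWc : IsClosed (W : Set (Lp ℝ 2 μ)) := Submodule.isClosed_topologicalClosure _
  have : CompleteSpace W := hWc.completeSpace_coe
  have hS : ∀ u ∈ W, smoothing μ k u ∈ leftInvariants H := by
    intro u hu
    have hcl : IsClosed {u | smoothing μ k u ∈ leftInvariants H} :=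
      (isClosed_leftInvariants H).preimage (smoothing μ k).continuous
    refine closure_minimal ?_ hcl hu
    rintro _ ⟨a, ha, rfl⟩ h hh
    exact (smoothing_toL2_leftTranslate μ k a h).symm.trans (by rw [ha h hh]; rfl)
  have hJ : ∀ a ∈ leftInvariants H, toL2 μ a ∈ W := fun a ha =>
    Submodule.le_topologicalClosure _ ⟨a, ha, rfl⟩
  have hTW : ∀ u ∈ W, (smoothingL2 μ k).toLinearMap u ∈ W := fun u hu => hJ _ (hS u hu)
  let T : W →L[ℝ] W := (smoothingL2 μ k).restrict hTW
  have hTc : IsCompactOperator T := (isCompactOperator_smoothingL2 μ k).restrict' hTW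
  have hTs : T.IsSymmetric := (isSymmetric_smoothingL2 μ k hk).restrict_invariant hTW
  have hbot := ContinuousLinearMap.orthogonalComplement_iSup_eigenspaces_eq_bot hTc hTs
  let F : W →L[ℝ] C(G, ℝ) := ((leftTranslate x - ContinuousLinearMap.id ℝ _).comp
    (smoothing μ k)).comp W.subtypeL
  have hF : ∀ u : W, F u = leftTranslate x (smoothing μ k u) - smoothing μ k u := fun u => rfl
  have hle : (⨆ r, Module.End.eigenspace (T : Module.End ℝ W) r) ≤ LinearMap.ker F.toLinearMap := by
    refine iSup_le fun r u hu => ?_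
    rw [Module.End.mem_eigenspace_iff] at hu
    have hu' : toL2 μ (smoothing μ k u) = r • (u : Lp ℝ 2 μ) := congrArg Subtype.val hu
    change F u = 0
    rw [hF, sub_eq_zero]
    -- The eigenspace for `0` may be infinite-dimensional, but smoothing kills it.
    by_cases hr : r = 0
    · have : smoothing μ k u = 0 := by
        apply ContinuousMap.toLp_injective (p := 2) (𝕜 := ℝ) μ
        exact hu'.trans (by rw [hr, zero_smul, map_zero])
      rw [this, map_zero]
    · refine hE r hr _ ?_ (hS u u.2)
      rw [mem_smoothingEigenspace, hu', map_smul]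
  have hcl : IsClosed (LinearMap.ker F.toLinearMap : Set W) := F.isClosed_ker
  have hall : ∀ u : W, F u = 0 := by
    have hd : (⨆ r, Module.End.eigenspace (T : Module.End ℝ W) r).topologicalClosure = ⊤ :=
      Submodule.topologicalClosure_eq_top_iff.2 hbot
    intro u
    have : u ∈ (⨆ r, Module.End.eigenspace (T : Module.End ℝ W) r).topologicalClosure :=
      hd ▸ Submodule.mem_top
    exact Submodule.topologicalClosure_minimal _ hle hcl this
  exact hne (sub_eq_zero.1 (hall ⟨toL2 μ f, hJ f hf⟩))

end PeterWeyl

/-! ### Orthogonal representations detecting points outside a closed subgroup -/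

section MatrixCoefficients

open MeasureTheory Matrix

instance Matrix.orthogonalGroup.instCompactSpace (X : Type*) [Fintype X] [DecidableEq X] :
    CompactSpace (orthogonalGroup X ℝ) := by
  refine isCompact_iff_compactSpace.1 ?_
  have hK : IsCompact (Set.univ.pi fun _ : X => Set.univ.pi fun _ : X => Set.Icc (-1 : ℝ) 1) :=
    isCompact_univ_pi fun _ => isCompact_univ_pi fun _ => isCompact_Icc
  refine hK.of_isClosed_subset (isClosed_unitary (R := Matrix X X ℝ)) fun A hA i _ j _ => ?_
  exact abs_le.1 (entry_norm_bound_of_unitary hA i j)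

variable {G : Type*} [Group G] [TopologicalSpace G] [IsTopologicalGroup G] [CompactSpace G]
  [MeasurableSpace G] [BorelSpace G] (μ : Measure G) [IsFiniteMeasure μ] [μ.IsMulLeftInvariant]
  {X : Type*} [Fintype X] [DecidableEq X]

theorem inner_toL2_leftTranslate_left (g : G) (a b : C(G, ℝ)) :
    inner ℝ (toL2 μ (leftTranslate g a)) (toL2 μ b) =
      inner ℝ (toL2 μ a) (toL2 μ (leftTranslate g⁻¹ b)) := by
  rw [← inner_toL2_leftTranslate μ g a, ← leftTranslate_mul, mul_inv_cancel, leftTranslate_one]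

/-- The orthogonal representation on the span of an orthonormal family of functions, if that span
is invariant under translation. -/
noncomputable def translationRep (c : X → C(G, ℝ))
    (hc : ∀ i j, inner ℝ (toL2 μ (c i)) (toL2 μ (c j)) = if i = j then (1 : ℝ) else 0)
    (hs : ∀ g j, leftTranslate g (c j) =
      ∑ i, (inner ℝ (toL2 μ (c i)) (toL2 μ (leftTranslate g (c j))) : ℝ) • c i) :
    G →ₜ* orthogonalGroup X ℝ :=
  let M : G → Matrix X X ℝ := fun g =>
    Matrix.of fun i j => inner ℝ (toL2 μ (c i)) (toL2 μ (leftTranslate g (c j)))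
  have hM1 : M 1 = 1 := by
    ext i j
    simp only [M, Matrix.of_apply, leftTranslate_one, hc, Matrix.one_apply]
  have hMm : ∀ g h, M (g * h) = M g * M h := by
    intro g h
    ext i j
    simp only [M, Matrix.of_apply, Matrix.mul_apply]
    have e := congrArg (leftTranslate g) (hs h j)
    rw [map_sum] at e
    rw [leftTranslate_mul, e]
    simp only [map_sum, map_smul, inner_sum, inner_smul_right]
    exact Finset.sum_congr rfl fun k _ => mul_comm _ _
  -- Translations are isometries of `L²`, so the adjoint of a translation is its inverse; this gives
  -- orthogonality.
  have hMt : ∀ g, star (M g) = M g⁻¹ := by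
    intro g
    ext i j
    simp only [M, Matrix.star_apply, Matrix.of_apply, star_trivial]
    rw [← inner_toL2_leftTranslate_left, real_inner_comm]
  { toFun := fun g => ⟨M g, by
      rw [Matrix.mem_unitaryGroup_iff, hMt, ← hMm, mul_inv_cancel, hM1]⟩
    map_one' := Subtype.ext hM1
    map_mul' := fun g h => Subtype.ext (hMm g h)
    continuous_toFun := by
      refine Continuous.subtype_mk (continuous_matrix fun i j => ?_) _
      have := continuous_leftTranslate (c j)
      exact continuous_const.inner ((toL2 μ).continuous.comp this) }

theorem translationRep_apply (c : X → C(G, ℝ)) (hc) (hs) (g : G) (i j : X) :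
    (translationRep μ c hc hs g : Matrix X X ℝ) i j =
      inner ℝ (toL2 μ (c i)) (toL2 μ (leftTranslate g (c j))) := rfl

/-- A finite-dimensional space of functions has an orthonormal basis starting with a given
direction. -/
theorem exists_orthonormal_family {Y : Type*} [TopologicalSpace Y] [CompactSpace Y]
    [MeasurableSpace Y] [BorelSpace Y] (μ : Measure Y) [IsFiniteMeasure μ] [μ.IsOpenPosMeasure]
    (E : Submodule ℝ C(Y, ℝ)) [FiniteDimensional ℝ E] {f : C(Y, ℝ)} (hf : f ∈ E) (hf0 : f ≠ 0) :
    ∃ (m : ℕ) (c : Unit ⊕ Fin m → C(Y, ℝ)),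
      (∀ i j, inner ℝ (toL2 μ (c i)) (toL2 μ (c j)) = if i = j then (1 : ℝ) else 0) ∧
      (∀ i, c i ∈ E) ∧
      (∀ a ∈ E, a = ∑ i, (inner ℝ (toL2 μ (c i)) (toL2 μ a) : ℝ) • c i) ∧
      ∃ r : ℝ, r ≠ 0 ∧ c (Sum.inl ()) = r • f := by
  have hinj : Function.Injective (toL2 μ) := ContinuousMap.toLp_injective μ
  let V : Submodule ℝ (Lp ℝ 2 μ) := E.map (toL2 μ).toLinearMap
  let u : V := ⟨toL2 μ f, f, hf, rfl⟩
  have hu : u ≠ 0 := fun h => hf0 (hinj ((congrArg Subtype.val h).trans (map_zero _).symm))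
  have : Nontrivial V := ⟨u, 0, hu⟩
  obtain ⟨m, hm⟩ : ∃ m, Module.finrank ℝ V = m + 1 :=
    Nat.exists_eq_succ_of_ne_zero Module.finrank_pos.ne'
  have hcard : Module.finrank ℝ V = Fintype.card (Unit ⊕ Fin m) := by
    rw [hm]; simp [add_comm]
  obtain ⟨b, hb⟩ := Orthonormal.exists_orthonormalBasis_extension_of_card_eq (𝕜 := ℝ) hcard
    (v := fun _ => ‖u‖⁻¹ • u) (s := {Sum.inl ()}) (by
      refine ⟨fun i => ?_, fun i j hij => (hij (Subsingleton.elim _ _)).elim⟩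
      simpa using norm_smul_inv_norm (𝕜 := ℝ) hu)
  choose c hcE hc using fun i => (b i).2
  have hc' : ∀ i, toL2 μ (c i) = b i := hc
  have hin : ∀ i (a : C(Y, ℝ)) (ha : a ∈ E),
      (inner ℝ (toL2 μ (c i)) (toL2 μ a) : ℝ) = inner ℝ (b i) (⟨toL2 μ a, a, ha, rfl⟩ : V) := by
    intro i a ha
    rw [hc', Submodule.coe_inner]
  refine ⟨m, c, fun i j => ?_, hcE, fun a ha => ?_, ‖u‖⁻¹, inv_ne_zero (norm_ne_zero_iff.2 hu), ?_⟩
  · rw [hc', hc', ← Submodule.coe_inner]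
    exact orthonormal_iff_ite.1 b.orthonormal i j
  · apply hinj
    have h := congrArg Subtype.val (b.sum_repr' (⟨toL2 μ a, a, ha, rfl⟩ : V))
    rw [map_sum]
    refine h.symm.trans ?_
    rw [Submodule.coe_sum]
    exact Finset.sum_congr rfl fun i _ => by rw [map_smul, hin i a ha, hc', Submodule.coe_smul]
  · apply hinj
    rw [hc', hb _ rfl, map_smul]
    rfl

/-- A point outside of a closed subgroup of a compact group is detected by an orthogonal
representation: it moves the line spanned by the first basis vector, which the subgroup fixes. -/
theorem exists_orthogonal_rep_of_notMem {G : Type*} [Group G] [TopologicalSpace G]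
    [IsTopologicalGroup G] [CompactSpace G] [T2Space G] {H : Subgroup G}
    (hH : IsClosed (H : Set G)) {x : G} (hx : x ∉ H) :
    ∃ (m : ℕ) (σ : G →ₜ* orthogonalGroup (Unit ⊕ Fin m) ℝ),
      (∀ h ∈ H, ∀ i, (σ h : Matrix (Unit ⊕ Fin m) (Unit ⊕ Fin m) ℝ) i (Sum.inl ()) = if i = Sum.inl () then 1 else 0) ∧
      ∃ t, (σ x : Matrix (Unit ⊕ Fin m) (Unit ⊕ Fin m) ℝ) (Sum.inr t) (Sum.inl ()) ≠ 0 := by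
  let _ : MeasurableSpace G := borel G
  have : BorelSpace G := ⟨rfl⟩
  let μ : Measure G := Measure.haarMeasure ⊤
  have hμ : μ.real Set.univ = 1 := by
    have : μ Set.univ = 1 := Measure.haarMeasure_self (K₀ := (⊤ : TopologicalSpace.PositiveCompacts G))
    simp [Measure.real, this]
  obtain ⟨E, hE, hEinv, f, hfE, hfH, hfx⟩ := exists_finiteDimensional_of_notMem hH hx
  have hone : ∀ g : G, leftTranslate g (1 : C(G, ℝ)) = 1 := fun g => rfl
  let E₁ : Submodule ℝ C(G, ℝ) := E ⊔ Submodule.span ℝ {1}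
  have hE₁inv : ∀ g, ∀ a ∈ E₁, leftTranslate g a ∈ E₁ := by
    intro g a ha
    obtain ⟨b, hb, z, hz, rfl⟩ := Submodule.mem_sup.1 ha
    obtain ⟨r, rfl⟩ := Submodule.mem_span_singleton.1 hz
    rw [map_add, map_smul, hone]
    exact Submodule.add_mem_sup (hEinv g b hb) hz
  -- Moving `f` is not enough: its line has to move. A constant is added to make the integral equal
  -- to `1`; translation preserves the integral, so `f₁` can only be mapped to a multiple of itself
  -- by being fixed.
  let f₁ : C(G, ℝ) := f + (1 - ∫ y, f y ∂μ) • 1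
  have hf₁E : f₁ ∈ E₁ := Submodule.add_mem_sup hfE
    (Submodule.smul_mem _ _ (Submodule.mem_span_singleton_self _))
  have hf₁t : ∀ g, leftTranslate g f₁ - f₁ = leftTranslate g f - f := by
    intro g
    simp only [f₁, map_add, map_smul, hone]
    abel
  have hint : ∫ y, f₁ y ∂μ = 1 := by
    have hi : Integrable (fun y => f y) μ :=
      f.continuous.integrable_of_hasCompactSupport (HasCompactSupport.of_compactSpace _)
    simp only [f₁, ContinuousMap.add_apply, ContinuousMap.smul_apply, ContinuousMap.one_apply]
    rw [integral_add hi (integrable_const _), integral_const, hμ]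
    simp
  have hf₁0 : f₁ ≠ 0 := by
    intro h
    simp [h] at hint
  obtain ⟨m, c, hc, hcE, hcs, r, hr, hcr⟩ := exists_orthonormal_family μ E₁ hf₁E hf₁0
  refine ⟨m, translationRep μ c hc fun g j => hcs _ (hE₁inv g _ (hcE j)), fun h hh i => ?_, ?_⟩
  · have : leftTranslate h (c (Sum.inl ())) = c (Sum.inl ()) := by
      rw [hcr, map_smul, sub_eq_zero.1 ((hf₁t h).trans (sub_eq_zero.2 (hfH h hh)))]
    rw [translationRep_apply, this, hc]
  · by_contra! hcon
    apply hfx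
    have h1 := hcs _ (hE₁inv x _ (hcE (Sum.inl ())))
    rw [Fintype.sum_sum_type] at h1
    simp only [translationRep_apply] at hcon
    simp only [hcon, zero_smul, Finset.sum_const_zero, add_zero, Finset.univ_unique,
      Finset.sum_singleton] at h1
    rw [PUnit.default_eq_unit] at h1
    generalize (inner ℝ (toL2 μ (c (Sum.inl ())))
      (toL2 μ (leftTranslate x (c (Sum.inl ())))) : ℝ) = s at h1
    rw [hcr, map_smul, smul_comm s] at h1
    have h2 : leftTranslate x f₁ = s • f₁ := smul_right_injective _ hr h1
    have h3 : ∫ y, leftTranslate x f₁ y ∂μ = ∫ y, f₁ y ∂μ :=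
      integral_mul_left_eq_self (fun y => f₁ y) x⁻¹
    rw [h2] at h3
    simp only [ContinuousMap.smul_apply, smul_eq_mul, integral_const_mul, hint, mul_one] at h3
    rw [h3, one_smul] at h2
    exact sub_eq_zero.1 ((hf₁t x).symm.trans (sub_eq_zero.2 h2))

end MatrixCoefficients

/-! ### Block sums, tensor products and reindexing of orthogonal matrices -/

section OrthogonalConstructions

open Matrix

variable {X Y : Type*} [Fintype X] [DecidableEq X] [Fintype Y] [DecidableEq Y]

theorem fromBlocks_mem_orthogonalGroup (A : orthogonalGroup X ℝ) (B : orthogonalGroup Y ℝ) :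
    fromBlocks (A : Matrix X X ℝ) 0 0 (B : Matrix Y Y ℝ) ∈ orthogonalGroup (X ⊕ Y) ℝ := by
  rw [mem_orthogonalGroup_iff, fromBlocks_transpose, fromBlocks_multiply]
  simp [(mem_orthogonalGroup_iff _ _).1 A.2, (mem_orthogonalGroup_iff _ _).1 B.2]

theorem submatrix_mem_orthogonalGroup (e : X ≃ Y) (A : orthogonalGroup X ℝ) :
    (A : Matrix X X ℝ).submatrix e.symm e.symm ∈ orthogonalGroup Y ℝ := by
  rw [mem_orthogonalGroup_iff, transpose_submatrix, submatrix_mul_equiv,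
    (mem_orthogonalGroup_iff _ _).1 A.2, submatrix_one_equiv]

/-- The block sum of two orthogonal matrices. -/
def orthogonalBlock : orthogonalGroup X ℝ × orthogonalGroup Y ℝ →ₜ* orthogonalGroup (X ⊕ Y) ℝ where
  toFun A := ⟨fromBlocks A.1 0 0 A.2, fromBlocks_mem_orthogonalGroup A.1 A.2⟩
  map_one' := Subtype.ext (by simp)
  map_mul' A B := Subtype.ext (by simp [fromBlocks_multiply])
  continuous_toFun := Continuous.subtype_mk (Continuous.matrix_fromBlocks
    (continuous_subtype_val.comp continuous_fst) continuous_const continuous_const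
    (continuous_subtype_val.comp continuous_snd)) _

theorem coe_orthogonalBlock (A : orthogonalGroup X ℝ) (B : orthogonalGroup Y ℝ) :
    (orthogonalBlock (A, B) : Matrix (X ⊕ Y) (X ⊕ Y) ℝ) = fromBlocks A 0 0 B := rfl

theorem orthogonalBlock_mulVec (A : orthogonalGroup X ℝ) (B : orthogonalGroup Y ℝ)
    (a : X → ℝ) (b : Y → ℝ) :
    (orthogonalBlock (A, B) : Matrix (X ⊕ Y) (X ⊕ Y) ℝ) *ᵥ Sum.elim a b =
      Sum.elim ((A : Matrix X X ℝ) *ᵥ a) ((B : Matrix Y Y ℝ) *ᵥ b) := by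
  rw [coe_orthogonalBlock, fromBlocks_mulVec]
  simp

theorem orthogonalBlock_injective_left {A A' : orthogonalGroup X ℝ} {B B' : orthogonalGroup Y ℝ}
    (h : orthogonalBlock (A, B) = orthogonalBlock (A', B')) : A = A' :=
  Subtype.ext (fromBlocks_inj.1 (congrArg Subtype.val h)).1

/-- The Kronecker product of two orthogonal matrices. -/
def orthogonalKronecker :
    orthogonalGroup X ℝ × orthogonalGroup Y ℝ →ₜ* orthogonalGroup (X × Y) ℝ where
  toFun A := ⟨kroneckerMap (· * ·) A.1 A.2, kronecker_mem_unitary A.1.2 A.2.2⟩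
  map_one' := Subtype.ext one_kronecker_one
  map_mul' _ _ := Subtype.ext (mul_kronecker_mul _ _ _ _)
  continuous_toFun := by
    refine Continuous.subtype_mk (continuous_matrix fun i j => ?_) _
    have h1 : Continuous fun A : orthogonalGroup X ℝ × orthogonalGroup Y ℝ =>
        (A.1 : Matrix X X ℝ) i.1 j.1 :=
      (continuous_subtype_val.comp continuous_fst).matrix_elem _ _
    have h2 : Continuous fun A : orthogonalGroup X ℝ × orthogonalGroup Y ℝ =>
        (A.2 : Matrix Y Y ℝ) i.2 j.2 :=
      (continuous_subtype_val.comp continuous_snd).matrix_elem _ _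
    exact h1.mul h2

theorem coe_orthogonalKronecker (A : orthogonalGroup X ℝ) (B : orthogonalGroup Y ℝ) :
    (orthogonalKronecker (A, B) : Matrix (X × Y) (X × Y) ℝ) = kroneckerMap (· * ·) A B := rfl

/-- Orthogonal matrices may be reindexed along an equivalence. -/
def orthogonalReindex (e : X ≃ Y) : orthogonalGroup X ℝ →ₜ* orthogonalGroup Y ℝ where
  toFun A := ⟨(A : Matrix X X ℝ).submatrix e.symm e.symm, submatrix_mem_orthogonalGroup e A⟩
  map_one' := Subtype.ext (submatrix_one_equiv _)
  map_mul' _ _ := Subtype.ext (submatrix_mul_equiv _ _ _ _ _).symm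
  continuous_toFun := Continuous.subtype_mk (continuous_subtype_val.matrix_submatrix _ _) _

/-- An orthogonal representation fixing the first basis vector restricts to the span of the other
basis vectors. -/
theorem exists_eq_orthogonalBlock_one {H : Type*} [Group H] [TopologicalSpace H]
    (σ : H →ₜ* orthogonalGroup (Unit ⊕ Y) ℝ)
    (hσ : ∀ h i, (σ h : Matrix (Unit ⊕ Y) (Unit ⊕ Y) ℝ) i (Sum.inl ()) =
      if i = Sum.inl () then 1 else 0) :
    ∃ τ : H →ₜ* orthogonalGroup Y ℝ, ∀ h, σ h = orthogonalBlock (1, τ h) := by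
  have hr : ∀ h t, (σ h : Matrix (Unit ⊕ Y) (Unit ⊕ Y) ℝ) (Sum.inl ()) (Sum.inr t) = 0 := by
    intro h t
    -- The inverse is the transpose, so the first row of `σ h` is the first column of `σ h⁻¹`.
    have h1 := hσ h⁻¹ (Sum.inr t)
    rw [map_inv] at h1
    simpa using h1
  have hb : ∀ h, (σ h : Matrix (Unit ⊕ Y) (Unit ⊕ Y) ℝ) =
      fromBlocks 1 0 0 (σ h : Matrix (Unit ⊕ Y) (Unit ⊕ Y) ℝ).toBlocks₂₂ := by
    intro h
    ext (i | i) (j | j)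
    · simp [hσ]
    · simp [hr]
    · simp [hσ]
    · rfl
  have hmul : ∀ g h, (σ (g * h) : Matrix (Unit ⊕ Y) (Unit ⊕ Y) ℝ).toBlocks₂₂ =
      (σ g : Matrix (Unit ⊕ Y) (Unit ⊕ Y) ℝ).toBlocks₂₂ *
        (σ h : Matrix (Unit ⊕ Y) (Unit ⊕ Y) ℝ).toBlocks₂₂ := by
    intro g h
    rw [map_mul, Submonoid.coe_mul, hb g, hb h, fromBlocks_multiply]
    simp
  refine ⟨{ toFun := fun h => ⟨(σ h : Matrix (Unit ⊕ Y) (Unit ⊕ Y) ℝ).toBlocks₂₂, ?_⟩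
            map_one' := ?_, map_mul' := fun g h => Subtype.ext (hmul g h),
            continuous_toFun := ?_ }, fun h => Subtype.ext (hb h)⟩
  · have h1 := mem_unitaryGroup_iff.1 (σ h).2
    rw [star_eq_conjTranspose, hb h, fromBlocks_conjTranspose, fromBlocks_multiply,
      ← fromBlocks_one, fromBlocks_inj] at h1
    rw [mem_unitaryGroup_iff, star_eq_conjTranspose]
    simpa using h1.2.2.2
  · refine Subtype.ext ?_
    simp only [map_one]
    ext i j
    simp [toBlocks₂₂, one_apply]
  · refine Continuous.subtype_mk (continuous_matrix fun i j => ?_) _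
    exact (continuous_subtype_val.comp σ.continuous_toFun).matrix_elem _ _

end OrthogonalConstructions

/-! ### Layered representations and the addition of a layer -/

section Layered

open Matrix

variable {I H : Type*} [Group H] [TopologicalSpace H] {G : I → Type*} [∀ i, Group (G i)]
  [∀ i, TopologicalSpace (G i)]

/-- Compatible orthogonal representations of a family of groups under `H` with retractions `p` to
`H`, on a sum of a lower and a top layer, both of which are invariant under `H`. All groups but
the one with index `j` preserve the layers and act on the top one through `H`. -/
structure LayeredRep (ι : ∀ i, H →ₜ* G i) (p : ∀ i, G i →ₜ* H) (j : Option I) where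
  Low : Type
  Top : Type
  [fintypeLow : Fintype Low]
  [fintypeTop : Fintype Top]
  [decidableEqLow : DecidableEq Low]
  [decidableEqTop : DecidableEq Top]
  low : H →ₜ* orthogonalGroup Low ℝ
  top : H →ₜ* orthogonalGroup Top ℝ
  rep : ∀ i, G i →ₜ* orthogonalGroup (Low ⊕ Top) ℝ
  rep_base : ∀ i h, rep i (ι i h) = orthogonalBlock (low h, top h)
  exists_low : ∀ i, some i ≠ j → ∃ A : G i →ₜ* orthogonalGroup Low ℝ,
    ∀ g, rep i g = orthogonalBlock (A g, top (p i g))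

attribute [instance] LayeredRep.fintypeLow LayeredRep.fintypeTop LayeredRep.decidableEqLow
  LayeredRep.decidableEqTop

namespace LayeredRep

variable {ι : ∀ i, H →ₜ* G i} {p : ∀ i, G i →ₜ* H} {j : Option I}

/-- The trivial one-dimensional representation, with empty lower layer. -/
def trivial : LayeredRep ι p j where
  Low := Empty
  Top := Unit
  low := 1
  top := 1
  rep _ := 1
  rep_base _ _ := (map_one orthogonalBlock).symm
  exists_low _ _ := ⟨1, fun _ => (map_one orthogonalBlock).symm⟩

/-- The action of a word on a vector. -/
def act (R : LayeredRep ι p j) (L : List (Σ i, G i)) (v : R.Low ⊕ R.Top → ℝ) :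
    R.Low ⊕ R.Top → ℝ :=
  L.foldr (fun x u => (R.rep x.1 x.2 : Matrix (R.Low ⊕ R.Top) (R.Low ⊕ R.Top) ℝ) *ᵥ u) v

theorem act_cons (R : LayeredRep ι p j) (x : Σ i, G i) (L : List (Σ i, G i))
    (v : R.Low ⊕ R.Top → ℝ) : R.act (x :: L) v =
      (R.rep x.1 x.2 : Matrix (R.Low ⊕ R.Top) (R.Low ⊕ R.Top) ℝ) *ᵥ R.act L v := rfl

/-- The images of a vector under the proper suffixes of a word stay in the lower layer. -/
def Confined (R : LayeredRep ι p j) (v : R.Low ⊕ R.Top → ℝ) : List (Σ i, G i) → Prop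
  | [] => True
  | _ :: L => R.Confined v L ∧ R.act L v ∘ Sum.inr = 0

theorem Confined.comp_inr_eq_zero {R : LayeredRep ι p j} {v : R.Low ⊕ R.Top → ℝ} :
    ∀ {L : List (Σ i, G i)}, R.Confined v L → L ≠ [] → v ∘ Sum.inr = 0
  | [_], h, _ => h.2
  | _ :: _ :: _, h, _ => Confined.comp_inr_eq_zero h.1 (List.cons_ne_nil _ _)

/-- Distributing the new tensor factor over the layers. -/
def layerEquiv (Y T D : Type) : Y ⊕ ((Unit ⊕ D) × T) ≃ (Y ⊕ T) ⊕ (D × T) :=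
  ((Equiv.refl Y).sumCongr ((Equiv.sumProdDistrib Unit D T).trans
    ((Equiv.punitProd T).sumCongr (Equiv.refl _)))).trans (Equiv.sumAssoc Y T (D × T)).symm

section Extend

variable (R : LayeredRep ι p j) {l : I} (hl : some l ≠ j) {D : Type} [Fintype D] [DecidableEq D]
  (σ : G l →ₜ* orthogonalGroup (Unit ⊕ D) ℝ) (τ : H →ₜ* orthogonalGroup D ℝ)

/-- The action on the lower layer of a group preserving the layers. -/
noncomputable def lowRep : G l →ₜ* orthogonalGroup R.Low ℝ := (R.exists_low l hl).choose

theorem rep_eq_lowRep (g : G l) : R.rep l g = orthogonalBlock (R.lowRep hl g, R.top (p l g)) :=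
  (R.exists_low l hl).choose_spec g

theorem lowRep_base (hp : ∀ i h, p i (ι i h) = h) (h : H) : R.lowRep hl (ι l h) = R.low h := by
  have h1 := R.rep_eq_lowRep hl (ι l h)
  rw [R.rep_base, hp] at h1
  exact (orthogonalBlock_injective_left h1).symm

/-- The representation mixing the top layer with a new one by a tensor product. -/
noncomputable def mixedRep : G l →ₜ* orthogonalGroup ((R.Low ⊕ R.Top) ⊕ (D × R.Top)) ℝ :=
  (orthogonalReindex (layerEquiv R.Low R.Top D)).comp (orthogonalBlock.comp
    ((R.lowRep hl).prod (orthogonalKronecker.comp (σ.prod (R.top.comp (p l))))))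

theorem coe_mixedRep (g : G l) :
    (R.mixedRep hl σ g).1 =
      (fromBlocks (R.lowRep hl g : Matrix R.Low R.Low ℝ) 0 0
        (kroneckerMap (· * ·) (σ g : Matrix (Unit ⊕ D) (Unit ⊕ D) ℝ)
          (R.top (p l g) : Matrix R.Top R.Top ℝ))).submatrix
        (layerEquiv R.Low R.Top D).symm (layerEquiv R.Low R.Top D).symm := rfl

/-- Over `H`, `(1 ⊕ τ) ⊗ top = top ⊕ (τ ⊗ top)`: the mixing disappears, and the result agrees with
the restriction to `H` of the layer-preserving action given to the other groups. -/
theorem mixedRep_base (hp : ∀ i h, p i (ι i h) = h)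
    (hτ : ∀ h, σ (ι l h) = orthogonalBlock (1, τ h)) (h : H) :
    R.mixedRep hl σ (ι l h) = orthogonalBlock (orthogonalBlock (R.low h, R.top h),
      orthogonalKronecker (τ h, R.top h)) := by
  refine Subtype.ext ?_
  rw [coe_mixedRep, hτ, hp, lowRep_base R hl hp, coe_orthogonalBlock, coe_orthogonalBlock,
    coe_orthogonalBlock, coe_orthogonalKronecker]
  ext ((y | t) | ⟨d, t⟩) ((y' | t') | ⟨d', t'⟩) <;> simp [layerEquiv]

theorem mixedRep_mulVec_low (g : G l) (u : R.Low ⊕ R.Top → ℝ) (hu : u ∘ Sum.inr = 0) :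
    (R.mixedRep hl σ g).1 *ᵥ Sum.elim u 0 =
      Sum.elim ((R.rep l g : Matrix (R.Low ⊕ R.Top) (R.Low ⊕ R.Top) ℝ) *ᵥ u) 0 := by
  have hu' : ∀ t, u (Sum.inr t) = 0 := congrFun hu
  rw [coe_mixedRep, rep_eq_lowRep R hl, coe_orthogonalBlock]
  ext ((y | t) | ⟨d, t⟩) <;>
    simp [layerEquiv, mulVec, dotProduct, Fintype.sum_sum_type, hu']

/-- The old top component sits as `e ⊗ u`, with `e` the first basis vector, and is sent to `σ g e ⊗
top (p l g) u`. The first column of `σ g` thus decides whether the vector reaches the new layer. -/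
theorem mixedRep_mulVec_inr (g : G l) (u : R.Low ⊕ R.Top → ℝ) (d : D) (t : R.Top) :
    ((R.mixedRep hl σ g).1 *ᵥ Sum.elim u 0)
        (Sum.inr (d, t)) =
      (σ g : Matrix (Unit ⊕ D) (Unit ⊕ D) ℝ) (Sum.inr d) (Sum.inl ()) *
        ((R.top (p l g) : Matrix R.Top R.Top ℝ) *ᵥ (u ∘ Sum.inr)) t := by
  rw [coe_mixedRep]
  simp [layerEquiv, mulVec, dotProduct, Fintype.sum_sum_type, Finset.mul_sum, mul_assoc]

open Classical in
/-- The family of representations in which one group mixes the top layer with a new one, while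
the other groups preserve the layers. -/
noncomputable def extendRep (i : I) : G i →ₜ* orthogonalGroup ((R.Low ⊕ R.Top) ⊕ (D × R.Top)) ℝ :=
  Function.update (fun i => orthogonalBlock.comp
    ((R.rep i).prod ((orthogonalKronecker.comp (τ.prod R.top)).comp (p i)))) l (R.mixedRep hl σ) i

theorem extendRep_self : R.extendRep hl σ τ l = R.mixedRep hl σ := by
  simp [extendRep]

theorem extendRep_of_ne {i : I} (hi : i ≠ l) (g : G i) : R.extendRep hl σ τ i g =
    orthogonalBlock (R.rep i g, orthogonalKronecker (τ (p i g), R.top (p i g))) := by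
  simp only [extendRep, ne_eq, hi, not_false_eq_true, Function.update_of_ne]
  rfl

/-- Adding a layer on top of a layered representation, by means of a representation of one of the
groups with a vector invariant under `H`. -/
noncomputable def extend (hp : ∀ i h, p i (ι i h) = h)
    (hτ : ∀ h, σ (ι l h) = orthogonalBlock (1, τ h)) : LayeredRep ι p (some l) where
  Low := R.Low ⊕ R.Top
  Top := D × R.Top
  low := orthogonalBlock.comp (R.low.prod R.top)
  top := orthogonalKronecker.comp (τ.prod R.top)
  rep := R.extendRep hl σ τ
  rep_base i h := by
    by_cases hi : i = l
    · subst hi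
      rw [extendRep_self]
      exact mixedRep_base R hl σ τ hp hτ h
    · rw [extendRep_of_ne R hl σ τ hi, hp, R.rep_base]
      rfl
  exists_low i hi := by
    have hi' : i ≠ l := fun h => hi (congrArg some h)
    exact ⟨R.rep i, extendRep_of_ne R hl σ τ hi'⟩

variable (hp : ∀ i h, p i (ι i h) = h) (hτ : ∀ h, σ (ι l h) = orthogonalBlock (1, τ h))

theorem extend_rep_mulVec (i : I) (g : G i) (u : R.Low ⊕ R.Top → ℝ) (hu : u ∘ Sum.inr = 0) :
    ((R.extend hl σ τ hp hτ).rep i g).1 *ᵥ (Sum.elim u 0 : (R.Low ⊕ R.Top) ⊕ (D × R.Top) → ℝ) =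
      Sum.elim ((R.rep i g : Matrix (R.Low ⊕ R.Top) (R.Low ⊕ R.Top) ℝ) *ᵥ u) 0 := by
  change (R.extendRep hl σ τ i g).1 *ᵥ Sum.elim u 0 = _
  by_cases hi : i = l
  · subst hi
    rw [extendRep_self]
    exact mixedRep_mulVec_low R hl σ g u hu
  · rw [extendRep_of_ne R hl σ τ hi]
    refine (orthogonalBlock_mulVec _ _ _ _).trans ?_
    rw [mulVec_zero]
    rfl

/-- Each letter is applied to the image under a proper suffix, which is confined to the old lower
layer, where old and new actions agree. The last letter may leave that layer, but lands in the old
space, which is the new lower layer. -/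
theorem extend_act {v : R.Low ⊕ R.Top → ℝ} : ∀ {L : List (Σ i, G i)}, R.Confined v L →
    (R.extend hl σ τ hp hτ).act L (Sum.elim v 0) = Sum.elim (R.act L v) 0
  | [], _ => rfl
  | x :: L, h => by
    rw [act_cons, extend_act h.1, act_cons]
    exact extend_rep_mulVec R hl σ τ hp hτ x.1 x.2 _ h.2

theorem Confined.extend {v : R.Low ⊕ R.Top → ℝ} : ∀ {L : List (Σ i, G i)}, R.Confined v L →
    (R.extend hl σ τ hp hτ).Confined (Sum.elim v 0) L
  | [], _ => True.intro
  | _ :: _, h => ⟨Confined.extend h.1, by rw [extend_act R hl σ τ hp hτ h.1]; rfl⟩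

end Extend

end LayeredRep

end Layered

/-! ### Reduced words and injectivity of the canonical map -/

section Soundness

open Matrix

/-- A split embedding has a continuous retraction. -/
theorem IsSplitEmbedding.exists_retraction {H G : Type*} [Group H] [TopologicalSpace H] [Group G]
    [TopologicalSpace G] {ι : H →ₜ* G} (hι : IsSplitEmbedding ι) :
    ∃ p : G →ₜ* H, ∀ h, p (ι h) = h := by
  obtain ⟨N, _, _, _, _, _, φ, _, e, he⟩ := hι
  refine ⟨⟨(SemidirectProduct.rightHom : N ⋊[φ] H →* H).comp (e : G →* N ⋊[φ] H), ?_⟩, fun h => ?_⟩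
  · have h1 : Continuous fun x : N ⋊[φ] H => (x.left, x.right) := continuous_induced_dom
    exact (continuous_snd.comp h1).comp e.continuous_toFun
  · change SemidirectProduct.rightHom (e (ι h)) = h
    rw [he, SemidirectProduct.rightHom_inr]

variable {I H : Type*} {G : I → Type*} [Group H] [TopologicalSpace H] [∀ i, Group (G i)]
  [∀ i, TopologicalSpace (G i)] {ι : ∀ i, H →ₜ* G i} {p : ∀ i, G i →ₜ* H}

/-- A nontrivial orthogonal matrix maps nonzero vectors to nonzero vectors. -/
theorem Matrix.orthogonalGroup.mulVec_ne_zero {X : Type*} [Fintype X] [DecidableEq X]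
    (A : orthogonalGroup X ℝ) {v : X → ℝ} (hv : v ≠ 0) : A.1 *ᵥ v ≠ 0 := by
  intro h
  apply hv
  have h1 : (star A.1 * A.1) *ᵥ v = 0 := by rw [← mulVec_mulVec, h, mulVec_zero]
  rwa [mem_unitaryGroup_iff'.1 A.2, one_mulVec] at h1

/-- A layered representation on which a word moves a vector out of the lower layer may be extended
so that this holds for the word with one more letter. -/
theorem LayeredRep.exists_of_cons [CompactSpace H] {j : Option I} (R : LayeredRep ι p j)
    (hp : ∀ i h, p i (ι i h) = h) {l : I} (hl : some l ≠ j) [IsTopologicalGroup (G l)]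
    [CompactSpace (G l)] [T2Space (G l)] {g : G l} (hg : g ∉ Set.range (ι l))
    {L : List (Σ i, G i)} {v : R.Low ⊕ R.Top → ℝ} (hc : R.Confined v L)
    (hne : R.act L v ∘ Sum.inr ≠ 0) :
    ∃ (R' : LayeredRep ι p (some l)) (v' : R'.Low ⊕ R'.Top → ℝ),
      R'.Confined v' (⟨l, g⟩ :: L) ∧ R'.act (⟨l, g⟩ :: L) v' ∘ Sum.inr ≠ 0 := by
  have hcl : IsClosed (((ι l : H →* G l).range : Subgroup (G l)) : Set (G l)) := by
    rw [MonoidHom.coe_range]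
    exact (isCompact_range (ι l).continuous_toFun).isClosed
  obtain ⟨m, σ, hσ, t, ht⟩ := exists_orthogonal_rep_of_notMem hcl (x := g) hg
  obtain ⟨τ, hτ'⟩ := exists_eq_orthogonalBlock_one (σ.comp (ι l)) fun h => hσ _ ⟨h, rfl⟩
  have hτ : ∀ h, σ (ι l h) = orthogonalBlock (1, τ h) := hτ'
  refine ⟨R.extend hl σ τ hp hτ, Sum.elim v 0,
    ⟨Confined.extend R hl σ τ hp hτ hc, ?_⟩, ?_⟩
  · rw [extend_act R hl σ τ hp hτ hc]
    rfl
  · rw [act_cons, extend_act R hl σ τ hp hτ hc]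
    change ((R.extendRep hl σ τ l g).1 *ᵥ Sum.elim (R.act L v) 0) ∘ Sum.inr ≠ 0
    rw [extendRep_self]
    -- The new top coordinate at `(t, s)` is a product of two nonzero factors: the entry by which
    -- `g` moves the line, and a coordinate of the rotated old top component.
    obtain ⟨s, hs⟩ := Function.ne_iff.1 (orthogonalGroup.mulVec_ne_zero (R.top (p l g)) hne)
    intro h
    have h1 := congrFun h (t, s)
    rw [Function.comp_apply, mixedRep_mulVec_inr] at h1
    exact mul_ne_zero ht hs h1

/-- Every reduced word acts on some layered representation so that it carries a vector from the
lower layer out of it. -/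
theorem LayeredRep.exists_of_reduced [CompactSpace H] [∀ i, IsTopologicalGroup (G i)]
    [∀ i, CompactSpace (G i)] [∀ i, T2Space (G i)] (hp : ∀ i h, p i (ι i h) = h) :
    ∀ L : List (Σ i, G i), L.IsChain (fun x y => x.1 ≠ y.1) →
      (∀ x ∈ L, x.2 ∉ Set.range (ι x.1)) →
      ∃ (R : LayeredRep ι p (L.head?.map Sigma.fst)) (v : R.Low ⊕ R.Top → ℝ),
        R.Confined v L ∧ R.act L v ∘ Sum.inr ≠ 0
  -- For the empty word confinement is void, so a vector of the top layer can serve.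
  | [], _, _ => ⟨LayeredRep.trivial, fun _ => 1, True.intro, fun h =>
      one_ne_zero (congrFun h ())⟩
  | ⟨l, g⟩ :: L, hL, hr => by
    obtain ⟨R, v, hc, hne⟩ := exists_of_reduced hp L hL.tail fun x hx =>
      hr x (List.mem_cons_of_mem _ hx)
    have hl : some l ≠ L.head?.map Sigma.fst := by
      cases L with
      | nil => simp
      | cons y L => simpa using (List.isChain_cons_cons.1 hL).1
    exact R.exists_of_cons hp hl (hr ⟨l, g⟩ List.mem_cons_self) hc hne

/-- Compatible continuous homomorphisms to a compact group see the kernel of the canonical map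
from the algebraic to the compact pushout. -/
theorem CompactPushout.lift_eq_one {K : Type*} [Group K] [TopologicalSpace K]
    [IsTopologicalGroup K] [CompactSpace K] [T2Space K] (f : ∀ i, G i →ₜ* K) (k : H →ₜ* K)
    (hf : ∀ i h, f i (ι i h) = k h) (Φ : AlgPushout ι →* K)
    (hof : ∀ i g, Φ (Monoid.PushoutI.of i g) = f i g)
    (hbase : ∀ h, Φ (Monoid.PushoutI.base _ h) = k h)
    {a : AlgPushout ι} (ha : CompactPushout.ofAlg ι a = 1) : Φ a = 1 := by
  obtain ⟨F, ⟨hF, hFb⟩, -⟩ := CompactPushout.existsUnique_desc ι f k hf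
  have h1 : Φ = (F : CompactPushout ι →* K).comp (CompactPushout.ofAlg ι) := by
    refine Monoid.PushoutI.hom_ext (fun i => ?_) ?_
    · ext g; simp [CompactPushout.ofAlg, hF, hof]
    · ext h; simp [CompactPushout.ofAlg, hFb, hbase]
  rw [h1, MonoidHom.comp_apply, ha, map_one]

/-- A family of continuous homomorphisms of compact groups with continuous retractions is
algebraically sound. -/
theorem algebraicallySound_of_retraction [IsTopologicalGroup H] [CompactSpace H] [T2Space H]
    [∀ i, IsTopologicalGroup (G i)] [∀ i, CompactSpace (G i)] [∀ i, T2Space (G i)] (hp : ∀ i h, p i (ι i h) = h) :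
    AlgebraicallySound ι := by
  refine (injective_iff_map_eq_one (CompactPushout.ofAlg ι)).2 fun a ha => ?_
  classical
  obtain ⟨d⟩ := Monoid.PushoutI.NormalWord.transversal_nonempty (fun i => (ι i : H →* G i))
    fun i => Function.LeftInverse.injective (hp i)
  obtain ⟨w, rfl⟩ := (Monoid.PushoutI.NormalWord.equiv (d := d)).symm.surjective a
  change CompactPushout.ofAlg ι w.prod = 1 at ha
  change w.prod = 1
  rw [Monoid.PushoutI.NormalWord.prod] at ha ⊢
  have hr : ∀ x ∈ w.toList, x.2 ∉ Set.range (ι x.1) := by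
    rintro ⟨i, g⟩ hx ⟨h, hh⟩
    obtain rfl : ι i h = g := hh
    refine w.ne_one _ hx ?_
    -- A normalized letter equals its own transversal component, which is `1` for a letter coming
    -- from `H`.
    have h1 := w.normalized i _ hx
    exact (Subgroup.IsComplement.coe_equiv_snd_eq_one_iff_mem (d.compl i) (d.one_mem i)).2 ⟨h, rfl⟩ ▸
      ((Subgroup.IsComplement.equiv_snd_eq_self_iff_mem (d.compl i) (one_mem _)).2 h1).symm
  obtain ⟨R, v, hc, hne⟩ := LayeredRep.exists_of_reduced hp w.toList w.chain_ne hr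
  have hlist : w.toList = [] := by
    by_contra hnil
    let Φ : AlgPushout ι →* orthogonalGroup (R.Low ⊕ R.Top) ℝ := Monoid.PushoutI.lift
      (fun i => (R.rep i : G i →* _)) (orthogonalBlock.comp (R.low.prod R.top) : H →* _)
      (fun i => MonoidHom.ext fun h => R.rep_base i h)
    have hof : ∀ i g, Φ (Monoid.PushoutI.of i g) = R.rep i g := fun i g => by simp [Φ]
    have hbase : ∀ h, Φ (Monoid.PushoutI.base _ h) = orthogonalBlock (R.low h, R.top h) :=
      fun h => by simp [Φ]
    have h1 := CompactPushout.lift_eq_one R.rep (orthogonalBlock.comp (R.low.prod R.top))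
      R.rep_base Φ hof hbase ha
    have hact : ∀ L : List (Σ i, G i), (Φ (Monoid.PushoutI.ofCoprodI
        (L.map fun x => Monoid.CoprodI.of x.2).prod)).1 *ᵥ v = R.act L v := by
      intro L
      induction L with
      | nil => simp [LayeredRep.act]
      | cons x L ih =>
        rw [List.map_cons, List.prod_cons, map_mul, map_mul, Monoid.PushoutI.ofCoprodI_of, hof,
          Submonoid.coe_mul, ← mulVec_mulVec, ih, LayeredRep.act_cons]
    -- Comparison of top components: the word gives `v` a nonzero one, the head acts on it
    -- invertibly, yet `v` itself has none.
    have h2 := congrArg (fun A : orthogonalGroup (R.Low ⊕ R.Top) ℝ => (A.1 *ᵥ v) ∘ Sum.inr) h1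
    simp only [map_mul, Submonoid.coe_mul, ← mulVec_mulVec] at h2
    rw [Monoid.CoprodI.Word.prod, hact, hbase, ← Sum.elim_comp_inl_inr (R.act w.toList v),
      orthogonalBlock_mulVec, Sum.elim_comp_inr, OneMemClass.coe_one, one_mulVec,
      hc.comp_inr_eq_zero hnil] at h2
    exact orthogonalGroup.mulVec_ne_zero _ hne h2
  have hprod : w.toWord.prod = 1 := by rw [Monoid.CoprodI.Word.prod, hlist]; rfl
  rw [hprod, map_one, mul_one] at ha ⊢
  -- Only the head in `H` is left, and the retractions form a cocone to `H` that recovers it.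
  have h1 := CompactPushout.lift_eq_one p (ContinuousMonoidHom.id H) hp
    (Monoid.PushoutI.lift (fun i => (p i : G i →* H)) (MonoidHom.id H)
      fun i => MonoidHom.ext fun h => hp i h) (fun i g => by simp) (fun h => by simp) ha
  rw [Monoid.PushoutI.lift_base] at h1
  rw [show w.head = 1 from h1, map_one]

end Soundness

theorem mainTheorem9 {I : Type*} {H : Type*} {G : I → Type*}
    [Group H] [TopologicalSpace H] [IsTopologicalGroup H] [CompactSpace H] [T2Space H]
    [∀ i, Group (G i)] [∀ i, TopologicalSpace (G i)] [∀ i, IsTopologicalGroup (G i)]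
    [∀ i, CompactSpace (G i)] [∀ i, T2Space (G i)]
    (ι : ∀ i, H →ₜ* G i) (hι : ∀ i, IsSplitEmbedding (ι i)) :
    AlgebraicallySound ι := by
  choose p hp using fun i => (hι i).exists_retraction
  exact algebraicallySound_of_retraction hp
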